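/- For a number field $K$ with ring of integers $\mathcal{O}_K$, let $i(K)=\gcd\{[\mathcal{O}_K:\mathbb{Z}[\theta]] : \theta\in\mathcal{O}_K,\ K=\mathbb{Q}(\theta)\}$ be the index of $K$, and call $K$ monogenic if $\mathcal{O}_K=\mathbb{Z}[\theta]$ for some $\theta\in\mathcal{O}_K$. Let $\nu_2$ denote the $2$-adic valuation. Let $m\neq\pm1$ be a rational integer such that $x^4-m$ is irreducible over $\mathbb{Q}$. If $m\equiv 1\pmod{16}$, then $\nu_2(i(K))=1$, where $K$ is the pure quartic field $\mathbb{Q}(\sqrt[4]{m})$. In particular, $K$ is not monogenic. -/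

import Mathlib

open Polynomial NumberField

/-- `ind(θ)`: the index of `ℤ[θ]` in the additive group of the ring of integers `𝓞 K`. -/
noncomputable def elementIndex {K : Type*} [Field K] [NumberField K] (θ : 𝓞 K) : ℕ :=
  (Subalgebra.toSubmodule (Algebra.adjoin ℤ {θ})).toAddSubgroup.index

/-- The indices `ind(θ)` of all integral `θ` with `K = ℚ(θ)`. -/
def primitiveIndices (K : Type*) [Field K] [NumberField K] : Set ℕ :=
  {n | ∃ θ : 𝓞 K, IntermediateField.adjoin ℚ {(θ : K)} = ⊤ ∧ elementIndex θ = n}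

/-- The greatest common divisor of a (possibly infinite) set of natural numbers: the nonnegative
generator of the ideal of `ℤ` spanned by the set. -/
noncomputable def natSetGcd (S : Set ℕ) : ℕ :=
  (Submodule.IsPrincipal.generator (Ideal.span ((fun n : ℕ => (n : ℤ)) '' S))).natAbs

/-- Sanity check: `natSetGcd S` has the universal property of the greatest common divisor. -/
theorem dvd_natSetGcd_iff (S : Set ℕ) (d : ℕ) : d ∣ natSetGcd S ↔ ∀ n ∈ S, d ∣ n := by
  rw [natSetGcd, ← Int.natCast_dvd, ← Ideal.span_singleton_le_span_singleton,
    Ideal.span_singleton_generator, Ideal.span_le]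
  simp [Set.subset_def, Ideal.mem_span_singleton, Int.natCast_dvd_natCast]

/-- The index `i(K)` of a number field: the gcd of all `ind(θ)`, `θ ∈ 𝓞 K` with `K = ℚ(θ)`. -/
noncomputable def fieldIndex (K : Type*) [Field K] [NumberField K] : ℕ :=
  natSetGcd (primitiveIndices K)

/-- `K` is monogenic if `𝓞 K = ℤ[θ]` for some `θ ∈ 𝓞 K`. -/
def IsMonogenicField (K : Type*) [Field K] [NumberField K] : Prop :=
  ∃ θ : 𝓞 K, Algebra.adjoin ℤ {θ} = ⊤

/-! The order `O` spanned by `1, α, ω, γ` has three distinct homomorphisms to `𝔽₂`, and every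
algebraic integer of `K` has an odd multiple in `O` (maximality at 2). As `𝔽₂` has only two
elements, any integer `θ` (up to an odd multiple) has the same image under two of them. These two
then agree on all of `ℤ[θ]`; if `ℤ[θ]` had odd index, they would agree on `O`. So 2 divides every
index, which also excludes monogenicity.

Conversely, `θ = α + ω` is primitive, and up to odd multiples `ℤ[θ]` contains `1, α, ω, 2γ`. Its
index is therefore an odd number times 1 or 2, so 4 does not divide the gcd. -/

/-- Multiplication table and linear independence of the elements `1, α, ω, γ`, where
`ω = (1 + α ^ 2) / 2`, `γ = (1 + α) * (1 + α ^ 2) / 4` and `α ^ 4 = 1 + 16 * k`. -/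
structure IsQuarticBasis {A : Type*} [CommRing A] (k : ℤ) (α ω γ : A) : Prop where
  αα : α * α = 2 * ω - 1
  αω : α * ω = 2 * γ - ω
  αγ : α * γ = γ + 4 * k
  ωω : ω * ω = ω + 4 * k
  ωγ : ω * γ = γ + 2 * k + 2 * k * α
  γγ : γ * γ = γ + 2 * k + 2 * k * α + 2 * k * ω
  indep : ∀ a b c d : ℤ, (a + b * α + c * ω + d * γ : A) = 0 → a = 0 ∧ b = 0 ∧ c = 0 ∧ d = 0

namespace IsQuarticBasis

/-! ### The order: residue homomorphisms and powers of `α + ω` -/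

section Order

variable {A : Type*} [CommRing A] {k : ℤ} {α ω γ : A}

/-- The order with `ℤ`-basis `1, α, ω, γ`. -/
def order (h : IsQuarticBasis k α ω γ) : Subring A where
  carrier := {x | ∃ a b c d : ℤ, x = a + b * α + c * ω + d * γ}
  mul_mem' := by
    rintro _ _ ⟨a, b, c, d, rfl⟩ ⟨a', b', c', d', rfl⟩
    refine ⟨a * a' - b * b' + 4 * k * (b * d' + d * b') + 4 * k * (c * c')
        + 2 * k * (c * d' + d * c') + 2 * k * (d * d'),
      a * b' + b * a' + 2 * k * (c * d' + d * c') + 2 * k * (d * d'),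
      a * c' + c * a' + 2 * (b * b') - (b * c' + c * b') + c * c' + 2 * k * (d * d'),
      a * d' + d * a' + 2 * (b * c' + c * b') + (b * d' + d * b') + (c * d' + d * c') + d * d', ?_⟩
    push_cast
    linear_combination (b * b' : A) * h.αα + (b * c' + c * b' : A) * h.αω
      + (b * d' + d * b' : A) * h.αγ + (c * c' : A) * h.ωω + (c * d' + d * c' : A) * h.ωγ
      + (d * d' : A) * h.γγ
  one_mem' := ⟨1, 0, 0, 0, by simp⟩
  add_mem' := by
    rintro _ _ ⟨a, b, c, d, rfl⟩ ⟨a', b', c', d', rfl⟩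
    exact ⟨a + a', b + b', c + c', d + d', by push_cast; ring⟩
  zero_mem' := ⟨0, 0, 0, 0, by simp⟩
  neg_mem' := by
    rintro _ ⟨a, b, c, d, rfl⟩
    exact ⟨-a, -b, -c, -d, by push_cast; ring⟩

theorem mem_order (h : IsQuarticBasis k α ω γ) {x : A} :
    x ∈ h.order ↔ ∃ a b c d : ℤ, x = a + b * α + c * ω + d * γ := Iff.rfl

theorem α_mem (h : IsQuarticBasis k α ω γ) : α ∈ h.order := ⟨0, 1, 0, 0, by simp⟩

theorem ω_mem (h : IsQuarticBasis k α ω γ) : ω ∈ h.order := ⟨0, 0, 1, 0, by simp⟩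

theorem γ_mem (h : IsQuarticBasis k α ω γ) : γ ∈ h.order := ⟨0, 0, 0, 1, by simp⟩

theorem coords_unique (h : IsQuarticBasis k α ω γ) {a b c d a' b' c' d' : ℤ}
    (e : (a + b * α + c * ω + d * γ : A) = a' + b' * α + c' * ω + d' * γ) :
    a = a' ∧ b = b' ∧ c = c' ∧ d = d' := by
  have := h.indep (a - a') (b - b') (c - c') (d - d') (by push_cast; linear_combination e)
  omega

/-- The homomorphisms from the order to `𝔽₂`. -/
theorem exists_residueHom (h : IsQuarticBasis k α ω γ) (s t : ZMod 2) (hst : s * t = t) :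
    ∃ φ : h.order →+* ZMod 2, ∀ (x : h.order) (a b c d : ℤ),
      (x : A) = a + b * α + c * ω + d * γ → φ x = a + b + c * s + d * t := by
  choose a b c d habcd using fun x : h.order => h.mem_order.1 x.2
  -- Coordinates are unique, so the formula may be evaluated on any expansion of `x`.
  have key : ∀ (x : h.order) (a' b' c' d' : ℤ), (x : A) = a' + b' * α + c' * ω + d' * γ →
      (a x + b x + c x * s + d x * t : ZMod 2) = a' + b' + c' * s + d' * t := by
    intro x a' b' c' d' e
    obtain ⟨h1, h2, h3, h4⟩ := h.coords_unique ((habcd x).symm.trans e)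
    rw [h1, h2, h3, h4]
  have two : (2 : ZMod 2) = 0 := rfl
  have idem : ∀ u : ZMod 2, u * u = u := by decide
  have hs := idem s
  have ht := idem t
  refine ⟨⟨⟨⟨fun x => a x + b x + c x * s + d x * t, ?_⟩, ?_⟩, ?_, ?_⟩, key⟩
  · simpa using key 1 1 0 0 0 (by simp)
  · intro x y
    refine (key (x * y) (a x * a y - b x * b y + 4 * k * (b x * d y + d x * b y)
        + 4 * k * (c x * c y) + 2 * k * (c x * d y + d x * c y) + 2 * k * (d x * d y))
      (a x * b y + b x * a y + 2 * k * (c x * d y + d x * c y) + 2 * k * (d x * d y))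
      (a x * c y + c x * a y + 2 * (b x * b y) - (b x * c y + c x * b y) + c x * c y
        + 2 * k * (d x * d y))
      (a x * d y + d x * a y + 2 * (b x * c y + c x * b y) + (b x * d y + d x * b y)
        + (c x * d y + d x * c y) + d x * d y) ?_).trans ?_
    · rw [Subring.coe_mul, habcd x, habcd y]
      push_cast
      linear_combination (b x * b y : A) * h.αα + (b x * c y + c x * b y : A) * h.αω
        + (b x * d y + d x * b y : A) * h.αγ + (c x * c y : A) * h.ωω
        + (c x * d y + d x * c y : A) * h.ωγ + (d x * d y : A) * h.γγ
    · push_cast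
      -- Modulo 2, with `α ↦ 1`, the multiplication table imposes only `s * t = t` beyond
      -- idempotence; the multiple of `two` absorbs the even terms.
      linear_combination (-(c x * c y) : ZMod 2) * hs - (c x * d y + d x * c y : ZMod 2) * hst
        - (d x * d y : ZMod 2) * ht
        + (-(b x * b y) + 2 * k * (b x * d y + d x * b y) + 2 * k * (c x * c y)
          + 2 * k * (c x * d y + d x * c y) + 2 * k * (d x * d y)
          + s * (b x * b y) - s * (b x * c y + c x * b y) + s * k * (d x * d y)
          + t * (b x * c y + c x * b y) : ZMod 2) * two
  · simpa using key 0 0 0 0 0 (by simp)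
  · intro x y
    refine (key (x + y) (a x + a y) (b x + b y) (c x + c y) (d x + d y) ?_).trans ?_
    · rw [Subring.coe_add, habcd x, habcd y]
      push_cast
      ring
    · push_cast
      ring

/-- Eliminating `α` and `ω` between the expansions of `θ`, `θ²`, `θ³` for `θ = α + ω` leaves `(10 +
32k)γ`, which is twice an odd multiple of `γ`. -/
theorem mul_γ_mem_adjoin (h : IsQuarticBasis k α ω γ) :
    (2 * (5 + 16 * k) : A) * γ ∈ Algebra.adjoin ℤ {α + ω} := by
  set S := Algebra.adjoin ℤ {α + ω}
  have hθ : α + ω ∈ S := Algebra.self_mem_adjoin_singleton ℤ _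
  have hk : (k : A) ∈ S := intCast_mem S k
  have e : (2 * (5 + 16 * k) : A) * γ = (α + ω) ^ 3 - 28 * k - (12 * k - 1) * (α + ω)
      + 8 * k * ((α + ω) ^ 2 - (4 * k - 1)) := by
    have h2 : (α + ω) ^ 2 = 4 * k - 1 + ω + 4 * γ := by
      linear_combination h.αα + 2 * h.αω + h.ωω
    have h3 : (α + ω) ^ 3 = 28 * k + (12 * k - 1) * α + (4 * k - 1) * ω + 10 * γ := by
      rw [pow_succ, h2]
      linear_combination h.αω + h.ωω + 4 * h.αγ + 4 * h.ωγ
    rw [h2, h3]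
    ring
  rw [e]
  have num : ∀ j : ℕ, [j.AtLeastTwo] → (OfNat.ofNat j : A) ∈ S := fun j _ => ofNat_mem S j
  exact add_mem (sub_mem (sub_mem (pow_mem hθ 3) (mul_mem (num _) hk))
    (mul_mem (sub_mem (mul_mem (num _) hk) (one_mem S)) hθ))
    (mul_mem (mul_mem (num _) hk) (sub_mem (pow_mem hθ 2)
      (sub_mem (mul_mem (num _) hk) (one_mem S))))

theorem ω_add_mem_adjoin (h : IsQuarticBasis k α ω γ) :
    ω + 4 * γ ∈ Algebra.adjoin ℤ {α + ω} := by
  set S := Algebra.adjoin ℤ {α + ω}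
  have hθ : α + ω ∈ S := Algebra.self_mem_adjoin_singleton ℤ _
  have e : ω + 4 * γ = (α + ω) ^ 2 - ((4 * k - 1 : ℤ) : A) := by
    push_cast
    linear_combination -h.αα - 2 * h.αω - h.ωω
  rw [e]
  exact sub_mem (pow_mem hθ 2) (intCast_mem S _)

end Order

/-! ### Maximality at 2 and parity of indices -/

section Integral

variable {A : Type*} [CommRing A] [Algebra.IsIntegral ℤ A] {k : ℤ} {α ω γ : A}

/-- Scaling the roots of a monic equation for `x` by 2 gives one for `y` that reduces to `Xⁿ` modulo
2. The point is that `x` itself need not lie in `S`. -/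
theorem _root_.map_eq_zero_of_eq_two_mul {S : Subring A} (φ : S →+* ZMod 2) {x : A} {y : S}
    (hy : (y : A) = 2 * x) : φ y = 0 := by
  obtain ⟨p, hp, hpx⟩ := Algebra.IsIntegral.isIntegral (R := ℤ) x
  have h1 : aeval (y : A) (p.scaleRoots 2) = 0 := by
    rw [hy]
    simpa using scaleRoots_aeval_eq_zero (R := ℤ) (r := 2) (a := x) (p := p) hpx
  have h2 : aeval y (p.scaleRoots 2) = 0 := by
    apply Subtype.ext
    have := Polynomial.hom_eval₂ (p.scaleRoots 2) (algebraMap ℤ S) S.subtype y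
    refine this.trans (Eq.trans ?_ h1)
    rw [aeval_def]
    congr 1
  have h3 := congrArg φ h2
  rw [aeval_def, Polynomial.hom_eval₂, map_zero, eval₂_eq_eval_map,
    map_scaleRoots _ _ _ (by simp [hp.leadingCoeff])] at h3
  have h4 : (φ.comp (algebraMap ℤ S)) 2 = 0 := by
    rw [map_ofNat]; rfl
  rw [h4, scaleRoots_zero] at h3
  have h5 : (p.map (φ.comp (algebraMap ℤ S))).leadingCoeff = 1 := (hp.map _).leadingCoeff
  rw [h5, one_smul, eval_pow, eval_X] at h3
  exact eq_zero_of_pow_eq_zero h3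

variable [IsDomain A] [CharZero A]

/-- The order is maximal at `2`. -/
theorem mem_order_of_two_mul_mem (h : IsQuarticBasis k α ω γ) {x : A} (hx : 2 * x ∈ h.order) :
    x ∈ h.order := by
  have two : (2 : A) ≠ 0 := two_ne_zero
  obtain ⟨φ₁, h₁⟩ := h.exists_residueHom 1 1 rfl
  obtain ⟨φ₂, h₂⟩ := h.exists_residueHom 1 0 rfl
  obtain ⟨φ₃, h₃⟩ := h.exists_residueHom 0 0 rfl
  obtain ⟨a, b, c, d, e⟩ := hx
  have e₁ := h₁ ⟨2 * x, a, b, c, d, e⟩ a b c d e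
  have e₂ := h₂ ⟨2 * x, a, b, c, d, e⟩ a b c d e
  have e₃ := h₃ ⟨2 * x, a, b, c, d, e⟩ a b c d e
  rw [map_eq_zero_of_eq_two_mul _ rfl] at e₁ e₂ e₃
  have f₁ : ((a + b + c + d : ℤ) : ZMod 2) = 0 := by push_cast; simpa using e₁.symm
  have f₂ : ((a + b + c : ℤ) : ZMod 2) = 0 := by push_cast; simpa using e₂.symm
  have f₃ : ((a + b : ℤ) : ZMod 2) = 0 := by push_cast; simpa using e₃.symm
  rw [ZMod.intCast_zmod_eq_zero_iff_dvd] at f₁ f₂ f₃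
  obtain ⟨c', rfl⟩ : (2 : ℤ) ∣ c := by push_cast at *; omega
  obtain ⟨d', rfl⟩ : (2 : ℤ) ∣ d := by push_cast at *; omega
  rcases Int.even_or_odd' b with ⟨b', rfl | rfl⟩
  · obtain ⟨a', rfl⟩ : (2 : ℤ) ∣ a := by push_cast at *; omega
    refine ⟨a', b', c', d', mul_left_cancel₀ two ?_⟩
    rw [e]
    push_cast
    ring
  -- The three homomorphisms do not exclude `a`, `b` both odd. In that case `(1 + α)/2` would be
  -- integral, and twice its square is `α + ω`, which the third homomorphism sends to 1.
  · obtain ⟨a', rfl⟩ : ∃ a', a = 2 * a' + 1 := ⟨a / 2, by push_cast at *; omega⟩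
    exfalso
    set z : A := x - (a' + b' * α + c' * ω + d' * γ) with hz
    have hz1 : 2 * z = 1 + α := by
      rw [hz, mul_sub, e]
      push_cast
      ring
    have hz2 : α + ω = 2 * (z * z) := by
      apply mul_left_cancel₀ two
      linear_combination (-2 * z - 1 - α) * hz1 - h.αα
    have e := h₃ ⟨α + ω, 0, 1, 1, 0, by simp⟩ 0 1 1 0 (by simp)
    rw [map_eq_zero_of_eq_two_mul _ hz2] at e
    simp at e

/-- Maximality at 2 lets factors of 2 be stripped from the multiplier one at a time. -/
theorem exists_odd_mul_mem (h : IsQuarticBasis k α ω γ)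
    (hgen : ∀ x : A, ∃ N : ℕ, N ≠ 0 ∧ N * x ∈ h.order) (x : A) :
    ∃ n : ℕ, Odd n ∧ n * x ∈ h.order := by
  obtain ⟨N, hN, hx⟩ := hgen x
  induction N using Nat.strong_induction_on with
  | _ N ih =>
    rcases Nat.even_or_odd' N with ⟨M, rfl | rfl⟩
    · refine ih M (by omega) (by omega) (h.mem_order_of_two_mul_mem ?_)
      push_cast at hx
      rwa [← mul_assoc]
    · exact ⟨_, ⟨M, rfl⟩, hx⟩

/-- An element whose powers generate a subgroup of odd index would separate three
homomorphisms to `𝔽₂`. -/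
theorem two_dvd_index (h : IsQuarticBasis k α ω γ)
    (hgen : ∀ x : A, ∃ N : ℕ, N ≠ 0 ∧ N * x ∈ h.order) (θ : A) :
    2 ∣ (Subalgebra.toSubmodule (Algebra.adjoin ℤ {θ})).toAddSubgroup.index := by
  by_contra hodd
  set Z := (Subalgebra.toSubmodule (Algebra.adjoin ℤ {θ})).toAddSubgroup with hZ
  rw [← even_iff_two_dvd, Nat.not_even_iff_odd] at hodd
  obtain ⟨n, hn, hnθ⟩ := h.exists_odd_mul_mem hgen θ
  have one_of_odd : ∀ {j : ℕ}, Odd j → (j : ZMod 2) = 1 := fun hj =>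
    ZMod.natCast_eq_one_iff_odd.2 hj
  have sep : ∀ φ ψ : h.order →+* ZMod 2, φ ⟨n * θ, hnθ⟩ = ψ ⟨n * θ, hnθ⟩ → φ = ψ := by
    intro φ ψ hφψ
    -- Elements of `ℤ[θ]` need not lie in the order, but odd multiples do, and odd factors become 1
    -- in `𝔽₂`.
    have claim : ∀ x ∈ Algebra.adjoin ℤ {θ}, ∃ j : ℕ, Odd j ∧ ∃ y : h.order,
        (y : A) = j * x ∧ φ y = ψ y := by
      intro x hx
      induction hx using Algebra.adjoin_induction with
      | mem x hx =>
        obtain rfl : x = θ := hx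
        exact ⟨n, hn, _, rfl, hφψ⟩
      | algebraMap r => exact ⟨1, odd_one, (r : h.order), by simp, by simp⟩
      | add x y _ _ hx hy =>
        obtain ⟨i, hi, u, hu, hu'⟩ := hx
        obtain ⟨j, hj, v, hv, hv'⟩ := hy
        refine ⟨i * j, hi.mul hj, j * u + i * v, ?_, by simp [hu', hv']⟩
        push_cast
        rw [hu, hv]
        ring
      | mul x y _ _ hx hy =>
        obtain ⟨i, hi, u, hu, hu'⟩ := hx
        obtain ⟨j, hj, v, hv, hv'⟩ := hy
        refine ⟨i * j, hi.mul hj, u * v, ?_, by simp [hu', hv']⟩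
        push_cast
        rw [hu, hv]
        ring
    ext1 x
    have hx : Z.index • (x : A) ∈ Z := Z.nsmul_index_mem x
    obtain ⟨j, hj, y, hy, hy'⟩ := claim _ hx
    have hyx : y = (j * Z.index : ℕ) * x := by
      apply Subtype.ext
      rw [hy]
      push_cast
      rw [nsmul_eq_mul, mul_assoc]
    rw [hyx] at hy'
    simpa [one_of_odd hj, one_of_odd hodd] using hy'
  obtain ⟨φ₁, h₁⟩ := h.exists_residueHom 1 1 rfl
  obtain ⟨φ₂, h₂⟩ := h.exists_residueHom 1 0 rfl
  obtain ⟨φ₃, h₃⟩ := h.exists_residueHom 0 0 rfl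
  have v₁ := h₁ ⟨γ, h.γ_mem⟩ 0 0 0 1 (by simp)
  have v₂ := h₂ ⟨γ, h.γ_mem⟩ 0 0 0 1 (by simp)
  have v₃ := h₃ ⟨γ, h.γ_mem⟩ 0 0 0 1 (by simp)
  have w₂ := h₂ ⟨ω, h.ω_mem⟩ 0 0 1 0 (by simp)
  have w₃ := h₃ ⟨ω, h.ω_mem⟩ 0 0 1 0 (by simp)
  have pigeon : ∀ a b c : ZMod 2, a = b ∨ a = c ∨ b = c := by decide
  rcases pigeon (φ₁ ⟨n * θ, hnθ⟩) (φ₂ ⟨n * θ, hnθ⟩) (φ₃ ⟨n * θ, hnθ⟩) with e | e | e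
  · simp [← sep _ _ e, v₁] at v₂
  · simp [← sep _ _ e, v₁] at v₃
  · simp [← sep _ _ e, w₂] at w₃

/-! ### Odd saturation and the index of `ℤ[α + ω]` -/

/-- The elements of `A` having an odd multiple in a given subgroup. -/
def _root_.AddSubgroup.oddSaturation {G : Type*} [AddCommGroup G] (Z : AddSubgroup G) :
    AddSubgroup G where
  carrier := {x | ∃ n : ℤ, Odd n ∧ n • x ∈ Z}
  zero_mem' := ⟨1, odd_one, by simp⟩
  add_mem' := by
    rintro x y ⟨i, hi, hx⟩ ⟨j, hj, hy⟩
    refine ⟨i * j, hi.mul hj, ?_⟩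
    rw [smul_add, mul_comm i j, mul_smul, mul_comm j i, mul_smul i j]
    exact add_mem (zsmul_mem hx _) (zsmul_mem hy _)
  neg_mem' := by
    rintro x ⟨i, hi, hx⟩
    exact ⟨i, hi, by simpa using hx⟩

theorem _root_.AddSubgroup.mem_oddSaturation_of_zsmul {G : Type*} [AddCommGroup G]
    {Z : AddSubgroup G} {n : ℤ} (hn : Odd n) {x : G} (hx : n • x ∈ Z.oddSaturation) :
    x ∈ Z.oddSaturation := by
  obtain ⟨j, hj, hx⟩ := hx
  exact ⟨j * n, hj.mul hn, by rwa [mul_smul]⟩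

theorem _root_.AddSubgroup.le_oddSaturation {G : Type*} [AddCommGroup G] (Z : AddSubgroup G) :
    Z ≤ Z.oddSaturation := fun x hx => ⟨1, odd_one, by simpa using hx⟩

/-- By Cauchy, an even relative index would give a class of order 2; but that class is also killed
by an odd integer, so it is trivial. Finite index makes Cauchy applicable. -/
theorem _root_.AddSubgroup.odd_relIndex_oddSaturation {G : Type*} [AddCommGroup G]
    (Z : AddSubgroup G) (hZ : Z.index ≠ 0) : Odd (Z.relIndex Z.oddSaturation) := by
  rw [← Nat.not_even_iff_odd, even_iff_two_dvd]
  intro hdvd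
  have hne : Z.relIndex Z.oddSaturation ≠ 0 := fun h0 => hZ <| by
    rw [← AddSubgroup.relIndex_mul_index Z.le_oddSaturation, h0, zero_mul]
  have : Finite (Z.oddSaturation ⧸ Z.addSubgroupOf Z.oddSaturation) :=
    (Nat.card_ne_zero.1 hne).2
  obtain ⟨q, hq⟩ := exists_prime_addOrderOf_dvd_card' (p := 2) hdvd
  obtain ⟨⟨x, n, ⟨j, rfl⟩, hx⟩, rfl⟩ := QuotientAddGroup.mk_surjective q
  have h2 := addOrderOf_nsmul_eq_zero (QuotientAddGroup.mk (s := Z.addSubgroupOf Z.oddSaturation)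
    ⟨x, 2 * j + 1, ⟨j, rfl⟩, hx⟩)
  rw [hq, ← QuotientAddGroup.mk_nsmul, QuotientAddGroup.eq_zero_iff,
    AddSubgroup.mem_addSubgroupOf] at h2
  have h2' : (2 : ℤ) • x ∈ Z := by rw [ofNat_zsmul]; simpa using h2
  have hxZ : x ∈ Z := by
    have := sub_mem hx (zsmul_mem h2' j)
    rwa [smul_smul, ← sub_smul, show 2 * j + 1 - j * 2 = (1 : ℤ) by ring, one_smul] at this
  have h0 : QuotientAddGroup.mk (s := Z.addSubgroupOf Z.oddSaturation)
      ⟨x, 2 * j + 1, ⟨j, rfl⟩, hx⟩ = 0 := by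
    rw [QuotientAddGroup.eq_zero_iff, AddSubgroup.mem_addSubgroupOf]
    exact hxZ
  rw [h0, addOrderOf_zero] at hq
  omega

/-- The index factors through the odd saturation `H`: the lower step is odd, and `γ` alone
represents any nontrivial class modulo `H`, with `2γ ∈ H`. -/
theorem not_four_dvd_index (h : IsQuarticBasis k α ω γ) [AddGroup.FG A]
    (hgen : ∀ x : A, ∃ N : ℕ, N ≠ 0 ∧ N * x ∈ h.order) :
    ¬ 4 ∣ (Subalgebra.toSubmodule (Algebra.adjoin ℤ {α + ω})).toAddSubgroup.index := by
  set Z := (Subalgebra.toSubmodule (Algebra.adjoin ℤ {α + ω})).toAddSubgroup with hZ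
  have hγ : (2 * (5 + 16 * k) : ℤ) • γ ∈ Z := by
    rw [zsmul_eq_mul]
    push_cast
    exact h.mul_γ_mem_adjoin
  have hω : ω + (4 : ℤ) • γ ∈ Z := by
    rw [zsmul_eq_mul]
    push_cast
    exact h.ω_add_mem_adjoin
  have hθ : α + ω ∈ Z := Algebra.self_mem_adjoin_singleton ℤ _
  have h1 : (1 : A) ∈ Z := one_mem (Algebra.adjoin ℤ {α + ω})
  have hodd := exists_odd_mul_mem h hgen
  have hD : Odd (5 + 16 * k) := ⟨2 + 8 * k, by ring⟩
  set H := Z.oddSaturation with hH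
  have hZH : Z ≤ H := Z.le_oddSaturation
  have γ2 : (2 : ℤ) • γ ∈ H := AddSubgroup.mem_oddSaturation_of_zsmul hD (hZH (by
    rwa [smul_smul, mul_comm]))
  have ωH : ω ∈ H := by
    have := sub_mem (hZH hω) (zsmul_mem γ2 2)
    rwa [smul_smul, show (2 * 2 : ℤ) = 4 by norm_num, add_sub_cancel_right] at this
  have αH : α ∈ H := by simpa using sub_mem (hZH hθ) ωH
  have dich : ∀ x : A, x ∈ H ∨ x + γ ∈ H := by
    intro x
    obtain ⟨n, hn, a, b, c, d, e⟩ := hodd x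
    have hn' : Odd (n : ℤ) := by exact_mod_cast hn
    have base : (a + b * α + c * ω : A) ∈ H := by
      have := add_mem (add_mem (zsmul_mem (hZH h1) a) (zsmul_mem αH b)) (zsmul_mem ωH c)
      simpa [zsmul_eq_mul] using this
    rcases Int.even_or_odd' d with ⟨j, rfl | rfl⟩
    · left
      refine AddSubgroup.mem_oddSaturation_of_zsmul hn' ?_
      have := add_mem base (zsmul_mem γ2 j)
      convert this using 1
      simp only [zsmul_eq_mul]
      push_cast at e ⊢
      rw [e]
      ring
    · right
      refine AddSubgroup.mem_oddSaturation_of_zsmul hn' ?_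
      obtain ⟨i, hi⟩ := hn'
      -- With `d = 2j + 1` and `n = 2i + 1`, the `γ`-coefficient of `n(x + γ)` is `2(j + i + 1)`.
      have := add_mem base (zsmul_mem γ2 (j + i + 1))
      convert this using 1
      have hi' : (n : A) = 2 * i + 1 := by exact_mod_cast congrArg (Int.cast (R := A)) hi
      simp only [zsmul_eq_mul]
      push_cast at e ⊢
      linear_combination e + γ * hi'
  have hHindex : H.index = 1 ∨ H.index = 2 := by
    by_cases hγH : γ ∈ H
    · left
      rw [AddSubgroup.index_eq_one, eq_top_iff]
      intro x _
      rcases dich x with hx | hx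
      · exact hx
      · simpa using sub_mem hx hγH
    · right
      rw [AddSubgroup.index_eq_two_iff]
      refine ⟨γ, fun x => ?_⟩
      rcases dich x with hx | hx
      · exact Or.inr ⟨hx, fun hx' => hγH (by simpa using sub_mem hx' hx)⟩
      · exact Or.inl ⟨hx, fun hx' => hγH (by simpa using sub_mem hx hx')⟩
  -- An infinite index counts as 0, which 4 divides, so finiteness of the quotient must be shown.
  have tors : IsAddTorsion (A ⧸ Z) := by
    intro q
    obtain ⟨x, rfl⟩ := QuotientAddGroup.mk_surjective q
    have hx2 : (2 : ℤ) • x ∈ H := by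
      rcases dich x with hx | hx
      · exact zsmul_mem hx 2
      · simpa [smul_add] using sub_mem (zsmul_mem hx 2) γ2
    obtain ⟨n, hn, hx⟩ := hx2
    rw [isOfFinAddOrder_iff_zsmul_eq_zero]
    refine ⟨n * 2, by rintro h0; obtain ⟨j, rfl⟩ := hn; omega, ?_⟩
    rw [← QuotientAddGroup.mk_zsmul, QuotientAddGroup.eq_zero_iff, mul_smul]
    exact hx
  have : Finite (A ⧸ Z) := AddCommGroup.finite_of_fg_isAddTorsion _ tors
  have hZ0 : Z.index ≠ 0 := Nat.card_pos.ne'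
  have hrel := Z.odd_relIndex_oddSaturation hZ0
  rw [← AddSubgroup.relIndex_mul_index hZH]
  rw [← hH] at hrel
  obtain ⟨j, hj⟩ := hrel
  rw [hj]
  rcases hHindex with e | e <;> rw [e] <;> omega

end Integral

end IsQuarticBasis

/-! ### Realising the basis in the pure quartic field -/

section PureQuartic

variable {K : Type*} [Field K] [CharZero K]

theorem linearIndependent_of_irreducible_pure_quartic {m : ℤ}
    (hirr : Irreducible (X ^ 4 - C (m : ℚ) : ℚ[X])) {α : K} (hα : α ^ 4 = (m : K))
    (a b c d : ℚ) (h0 : (a + b * α + c * α ^ 2 + d * α ^ 3 : K) = 0) :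
    a = 0 ∧ b = 0 ∧ c = 0 ∧ d = 0 := by
  have hmin : X ^ 4 - C (m : ℚ) = minpoly ℚ α :=
    minpoly.eq_of_irreducible_of_monic hirr (by simp [hα])
      (monic_X_pow_sub_C _ (by norm_num))
  have hp : C a + C b * X + C c * X ^ 2 + C d * X ^ 3 = (0 : ℚ[X]) := by
    by_contra hne
    have hle := minpoly.degree_le_of_ne_zero ℚ α hne (by simpa using h0)
    rw [← hmin, degree_X_pow_sub_C (by norm_num)] at hle
    have : (C a + C b * X + C c * X ^ 2 + C d * X ^ 3 : ℚ[X]).degree ≤ 3 := by compute_degree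
    exact absurd (hle.trans this) (by decide)
  refine ⟨?_, ?_, ?_, ?_⟩
  · simpa [coeff_X, coeff_C] using congrArg (fun p => coeff p 0) hp
  · simpa [coeff_X, coeff_C] using congrArg (fun p => coeff p 1) hp
  · simpa [coeff_X, coeff_C] using congrArg (fun p => coeff p 2) hp
  · simpa [coeff_X, coeff_C] using congrArg (fun p => coeff p 3) hp

theorem isIntegral_ω {k : ℤ} {α : K} (hα : α ^ 4 = 1 + 16 * k) :
    IsIntegral ℤ ((1 + α ^ 2) / 2) := by
  refine ⟨X ^ 2 - X - C (4 * k), by monicity!, ?_⟩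
  have hk : (k : K) = (α ^ 4 - 1) / 16 := by rw [hα]; ring
  simp only [eval₂_sub, eval₂_pow, eval₂_X, eval₂_C]
  push_cast [eq_intCast, hk]
  ring

theorem isIntegral_γ {k : ℤ} {α : K} (hα : α ^ 4 = 1 + 16 * k) :
    IsIntegral ℤ ((1 + α) * (1 + α ^ 2) / 4) := by
  refine ⟨X ^ 4 - X ^ 3 - C (6 * k) * X ^ 2 - C (16 * k ^ 2) * X - C (16 * k ^ 3),
    by monicity!, ?_⟩
  have hk : (k : K) = (α ^ 4 - 1) / 16 := by rw [hα]; ring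
  simp only [eval₂_sub, eval₂_mul, eval₂_pow, eval₂_X, eval₂_C]
  push_cast [eq_intCast, hk]
  ring

end PureQuartic

theorem exists_isQuarticBasis {K : Type*} [Field K] [NumberField K] {k : ℤ}
    (hirr : Irreducible (X ^ 4 - C ((1 + 16 * k : ℤ) : ℚ) : ℚ[X])) {α : K}
    (hα : α ^ 4 = ((1 + 16 * k : ℤ) : K)) :
    ∃ α' ω γ : 𝓞 K, (α' : K) = α ∧ IsQuarticBasis k α' ω γ := by
  have hα' : α ^ 4 = 1 + 16 * k := by rw [hα]; push_cast; ring
  have iα : IsIntegral ℤ α := ⟨X ^ 4 - C (1 + 16 * k), by monicity!, by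
    rw [eval₂_sub, eval₂_pow, eval₂_X, eval₂_C, hα', eq_intCast]
    push_cast
    ring⟩
  -- Eliminating `k` turns each entry of the multiplication table into a polynomial identity in `α`.
  have hk : (k : K) = (α ^ 4 - 1) / 16 := by rw [hα']; ring
  have lift : ∀ {x : K}, IsIntegral ℤ x → ∃ y : 𝓞 K, algebraMap (𝓞 K) K y = x :=
    fun hx => ⟨⟨_, hx⟩, rfl⟩
  obtain ⟨α', eα⟩ := lift iα
  obtain ⟨ω, eω⟩ := lift (isIntegral_ω hα')
  obtain ⟨γ, eγ⟩ := lift (isIntegral_γ hα')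
  refine ⟨α', ω, γ, eα, ?_, ?_, ?_, ?_, ?_, ?_, ?_⟩
  iterate 6
    apply RingOfIntegers.coe_injective
    simp only [map_mul, map_add, map_sub, map_one, map_ofNat, map_intCast,
      eα, eω, eγ, hk]
    ring
  intro a b c d h0
  have h1 := congrArg (algebraMap (𝓞 K) K) h0
  simp only [map_add, map_mul, map_intCast, eα, eω, eγ, map_zero] at h1
  obtain ⟨e0, e1, e2, e3⟩ := linearIndependent_of_irreducible_pure_quartic hirr hα
    -- The coefficients of `4(a + bα + cω + dγ)` in `1, α, α², α³`.
    (4 * a + 2 * c + d) (4 * b + d) (2 * c + d) d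
    (by push_cast; linear_combination 4 * h1)
  norm_cast at e0 e1 e2 e3
  omega

theorem IsQuarticBasis.exists_mul_mem_order {K : Type*} [Field K] [NumberField K] {k : ℤ}
    {α ω γ : 𝓞 K} (h : IsQuarticBasis k α ω γ)
    (hK : IntermediateField.adjoin ℚ {(α : K)} = ⊤) (x : 𝓞 K) :
    ∃ N : ℕ, N ≠ 0 ∧ N * x ∈ h.order := by
  have hx : (x : K) ∈ Algebra.adjoin ℚ {(α : K)} := by
    rw [← IntermediateField.adjoin_simple_toSubalgebra_of_isAlgebraic
      (Algebra.IsAlgebraic.isAlgebraic (α : K)), hK]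
    trivial
  suffices ∀ z ∈ Algebra.adjoin ℚ {(α : K)}, ∃ N : ℕ, N ≠ 0 ∧ ∃ y ∈ h.order, N * z = algebraMap (𝓞 K) K y by
    obtain ⟨N, hN, y, hy, e⟩ := this x hx
    refine ⟨N, hN, ?_⟩
    convert hy
    apply RingOfIntegers.ext
    simpa using e
  intro z hz
  induction hz using Algebra.adjoin_induction with
  | mem z hz =>
    obtain rfl : z = α := hz
    exact ⟨1, one_ne_zero, α, h.α_mem, by simp⟩
  | algebraMap r =>
    refine ⟨r.den, r.den_nz, (r.num : 𝓞 K), intCast_mem _ _, ?_⟩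
    have := congrArg (Rat.cast (K := K)) (Rat.den_mul_eq_num r)
    push_cast at this
    simpa using this
  | add x y _ _ hx hy =>
    obtain ⟨i, hi, u, hu, eu⟩ := hx
    obtain ⟨j, hj, v, hv, ev⟩ := hy
    refine ⟨i * j, mul_ne_zero hi hj, j * u + i * v,
      add_mem (mul_mem (natCast_mem _ _) hu) (mul_mem (natCast_mem _ _) hv), ?_⟩
    simp only [map_add, map_mul, map_natCast, Nat.cast_mul]
    rw [← eu, ← ev]
    ring
  | mul x y _ _ hx hy =>
    obtain ⟨i, hi, u, hu, eu⟩ := hx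
    obtain ⟨j, hj, v, hv, ev⟩ := hy
    refine ⟨i * j, mul_ne_zero hi hj, u * v, mul_mem hu hv, ?_⟩
    simp only [map_mul, Nat.cast_mul]
    rw [← eu, ← ev]
    ring

/-- Over `ℚ` the nonzero factor `10 + 32k` can be inverted, recovering `γ`, then `ω`, then `α` from
`α + ω`. -/
theorem IsQuarticBasis.adjoin_add_eq_top {K : Type*} [Field K] [NumberField K] {k : ℤ}
    {α ω γ : 𝓞 K} (h : IsQuarticBasis k α ω γ)
    (hK : IntermediateField.adjoin ℚ {(α : K)} = ⊤) :
    IntermediateField.adjoin ℚ {((α + ω : 𝓞 K) : K)} = ⊤ := by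
  set F := IntermediateField.adjoin ℚ {((α + ω : 𝓞 K) : K)} with hF
  have hθ : ((α + ω : 𝓞 K) : K) ∈ F := IntermediateField.mem_adjoin_simple_self ℚ _
  have sub : ∀ x ∈ Algebra.adjoin ℤ {α + ω}, (x : K) ∈ F := by
    intro x hx
    induction hx using Algebra.adjoin_induction with
    | mem x hx =>
      obtain rfl : x = α + ω := hx
      exact hθ
    | algebraMap r => simp
    | add x y _ _ hx hy => simpa using add_mem hx hy
    | mul x y _ _ hx hy => simpa using mul_mem hx hy
  have hγ : (γ : K) ∈ F := by
    have := sub _ h.mul_γ_mem_adjoin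
    have hne : ((2 * (5 + 16 * k) : ℤ) : K) ≠ 0 := Int.cast_ne_zero.2 (by omega)
    have h2 := mul_mem (inv_mem (intCast_mem F (2 * (5 + 16 * k)))) this
    simp only [map_mul, map_add, map_ofNat, map_intCast] at h2
    push_cast at h2 hne
    rwa [inv_mul_cancel_left₀ hne] at h2
  have hω : (ω : K) ∈ F := by
    have := sub_mem (sub _ h.ω_add_mem_adjoin) (mul_mem (ofNat_mem F 4) hγ)
    simpa only [map_add, map_mul, map_ofNat, add_sub_cancel_right] using this
  have hα : (α : K) ∈ F := by simpa using sub_mem hθ hω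
  rw [eq_top_iff, ← hK, IntermediateField.adjoin_simple_le_iff]
  exact hα

theorem mainTheorem6 (m : ℤ) (hm1 : m ≠ 1) (hm2 : m ≠ -1)
    (hirr : Irreducible (X ^ 4 - C (m : ℚ) : ℚ[X])) (hm : m ≡ 1 [ZMOD 16])
    (K : Type*) [Field K] [NumberField K] (α : K) (hα : α ^ 4 = (m : K))
    (hK : IntermediateField.adjoin ℚ {α} = ⊤) :
    padicValNat 2 (fieldIndex K) = 1 ∧ ¬ IsMonogenicField K := by
  obtain ⟨k, rfl⟩ : ∃ k, m = 1 + 16 * k := by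
    obtain ⟨k, hk⟩ := hm.symm.dvd
    exact ⟨k, by omega⟩
  obtain ⟨α, ω, γ, rfl, h⟩ := exists_isQuarticBasis hirr hα
  have hgen := h.exists_mul_mem_order hK
  -- Primitivity of `θ` is not needed: an infinite index counts as 0, which is even.
  have h2 : ∀ θ : 𝓞 K, 2 ∣ elementIndex θ := h.two_dvd_index hgen
  have : AddGroup.FG (𝓞 K) := AddGroup.fg_iff_addMonoid_fg.2
    (Module.Finite.iff_addMonoid_fg.1 inferInstance)
  have h4 : ¬ 4 ∣ elementIndex (α + ω) := h.not_four_dvd_index hgen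
  constructor
  · have d2 : 2 ∣ fieldIndex K := by
      rw [fieldIndex, dvd_natSetGcd_iff]
      rintro _ ⟨θ, -, rfl⟩
      exact h2 θ
    have d4 : ¬ 4 ∣ fieldIndex K := by
      rw [fieldIndex, dvd_natSetGcd_iff]
      exact fun hall => h4 (hall _ ⟨α + ω, h.adjoin_add_eq_top hK, rfl⟩)
    -- `padicValNat` is 0 at 0, so the gcd must be known to be nonzero.
    have hne : fieldIndex K ≠ 0 := fun h0 => d4 (h0 ▸ dvd_zero 4)
    refine le_antisymm ?_ (one_le_padicValNat_of_dvd hne d2)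
    by_contra! hlt
    exact d4 ((padicValNat_dvd_iff_le (p := 2) (n := 2) hne).2 hlt)
  · rintro ⟨θ, hθ⟩
    have := h2 θ
    rw [elementIndex, hθ] at this
    simp at this
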